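/- Let $N,K,P,\rho$ be integers. There are $N$ independent files, each uniform over $F$ bits, $P$ servers and $K$ users. User $j$ is connected to a set $\mathcal Z_j\subseteq[P]$ of exactly $\rho$ servers and requests file $d_j\in[N]$; the requests $d_1,\dots,d_K$ are distinct. Each file $W_i$ is partitioned into segments $W_{i,\mathcal A}$, $\mathcal A\subseteq[K]$, where $W_{i,\mathcal A}$ is cached (uncoded) exactly by the users in $\mathcal A$. Server $p$ stores a coded subsegment $C^p_{i,\mathcal A}$, a function of the single segment $W_{i,\mathcal A}$ (no inter-file coding), such that any $\rho$ of the coded subsegments of a segment determine it. Fix $R_1,\dots,R_P\ge 0$ with $\sum_pR_p>0$; server $p$ transmits a message $X_p$ of $n_p=\lfloor FR_p\rfloor$ bits, and rates are measured relative to the total length $n=F\sum_pR_p$ of the successive transmissions. For every user $j$, every $\mathcal A\subseteq[K]\setminus\{j\}$ and every server $p$ let $r^p_{j,\mathcal A}\ge0$ be the rate at which server $p$ delivers the coded subsegment for the segment $W_{d_j,\mathcal A}$: the delivered subsegment $D^p_{j,\mathcal A}$ is a function of $C^p_{d_j,\mathcal A}$, uniform over $\lfloor n r^p_{j,\mathcal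 A}\rfloor$ bits, and $\sum_{p\in\mathcal Z_j} n\,r^p_{j,\mathcal A}\ge |W_{d_j,\mathcal A}|$. Server $p$ computes $X_p$ from the subsegments $D^p_{i,\mathcal B}$. User $j$ estimates $D^p_{j,\mathcal A}$ from the segments in its cache and from those messages $X_q$ with $q\in\mathcal Z_j\cap\mathcal H_p$, where $\mathcal H_p\ni p$ is a set of servers (chosen with the code) that send subsegments distinct from those of server $p$, in the sense that each $D^p_{i,\mathcal B}$ is uniform conditionally on $(D^q_{i,\mathcal B})_{q\in\mathcal H_p\setminus\{p\}}$. (For $\mathcal H_p=\{p\}$ these are $P$ separate index coding problems.) The rate tuple is achievable if for every $\varepsilon>0$ and all large enough $F$ there is such a code in which every $D^p_{j,\mathcal A}$ is estimated with error probability less than $\varepsilon$; the segment sizes, the functions and the sets $\mathcal H_p$ may depend on $\varepsilon$ and $F$. Let $G_p$ be the directed graph whose nodes are the pairs $(j,\mathcal A)$ with $p\in\mathcal Z_j$ and $\mathcal A\subseteq[K]\setminus\{j\}$, with an edge from $(i,\mathcal A)$ to $(j,\mathcal B)$ if and only if $j\in\mathcal A$. **Theorem.** If the rate tuple $(r^p_{j,\mathcal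 A})$ is achievable, then $r^p_{j,\mathcal A}=0$ whenever server $p$ does not serve user $j$ (i.e. $p\notin\mathcal Z_j$), and for all sets $\mathcal J_p$ of nodes of $G_p$, $p\in[P]$, such that the subgraph of $G_p$ over $\mathcal J_p$ contains no directed cycle, $$\sum_{p=1}^P\ \sum_{(j,\mathcal A)\in\mathcal J_p} r^p_{j,\mathcal A}\le 1,$$ and moreover, for each server $p$, $\big(\sum_{q}R_q\big)\sum_{(j,\mathcal A)\in\mathcal J_p} r^p_{j,\mathcal A}\le R_p$ (that is, with rates measured relative to the length $FR_p$ of server $p$'s own message, each inner sum is at most $1$ if $R_p>0$). -/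

import Mathlib

namespace MultiServer

/-- Strings of `m` bits. -/
abbrev Bits (m : ℕ) : Type := Fin m → Bool

/-- The requested segments: a pair `(j, A)` stands for the segment of the file requested by user `j`
that is cached exactly by the users in `A`, where `j ∉ A`. -/
abbrev Node (K : ℕ) : Type := {x : Fin K × Finset (Fin K) // x.1 ∉ x.2}

/-- The user that requests the segment. -/
abbrev Node.user {K : ℕ} (v : Node K) : Fin K := v.1.1

/-- The users that cache the segment. -/
abbrev Node.cachers {K : ℕ} (v : Node K) : Finset (Fin K) := v.1.2

/-- The nodes of the index coding problem of server `p`: the segments requested by the users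
that are served by `p`. Here `Z j` is the set of servers that user `j` is connected to. -/
abbrev ServedNode {K P : ℕ} (Z : Fin K → Finset (Fin P)) (p : Fin P) : Type :=
  {v : Node K // p ∈ Z v.user}

/-- The side information graph of server `p`: there is an edge from `v` to `w` if the user that
requests `w` caches `v`. -/
def sideInfoGraph {K P : ℕ} (Z : Fin K → Finset (Fin P)) (p : Fin P) :
    Digraph (ServedNode Z p) where
  Adj v w := w.1.user ∈ v.1.cachers

/-- The subgraph of `G` over the vertex set `J` contains no directed cycle. -/
def AcyclicOn {V : Type*} (G : Digraph V) (J : Finset V) : Prop :=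
  ∀ v, ¬ Relation.TransGen (fun a b => a ∈ J ∧ b ∈ J ∧ G.Adj a b) v v

/-- A code for files of `F` bits, the topology `Z` and the demands `d`, in which server `p` transmits
`n p` bits and has to deliver a coded subsegment of `m p v` bits for the request `v`. The file
library is `W i A`, `i : Fin N`, `A ⊆ Fin K`, where the segment `W i A` of file `i` is cached,
uncoded, exactly by the users in `A`. -/
structure Code {N K P : ℕ} (ρ : ℕ) (Z : Fin K → Finset (Fin P)) (d : Fin K → Fin N) (F : ℕ)
    (n : Fin P → ℕ) (m : Fin P → Node K → ℕ) where
  /-- The number of bits of each segment. -/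
  len : Fin N → Finset (Fin K) → ℕ
  /-- The segments partition the file. -/
  len_sum : ∀ i, ∑ A, len i A = F
  /-- The number of bits of each stored coded subsegment. -/
  storeLen : Fin P → Fin N → Finset (Fin K) → ℕ
  /-- The coded subsegment that server `p` stores of segment `A` of file `i`. It depends on this
  segment only: there is no coding across files. -/
  store : ∀ p i A, Bits (len i A) → Bits (storeLen p i A)
  /-- Any `ρ` coded subsegments of a segment determine the segment. -/
  recover : ∀ i A (S : Finset (Fin P)), S.card = ρ →
    Function.Injective (fun (w : Bits (len i A)) (p : S) => store p i A w)
  /-- What server `p` has to deliver, out of its stored coded subsegment, for the request `v`. -/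
  extract : ∀ p (v : Node K), Bits (storeLen p (d v.user) v.cachers) →
    Bits (m p v)
  /-- The servers whose transmissions may be used in decoding the subsegments of server `p`. -/
  helpers : Fin P → Finset (Fin P)
  self_mem_helpers : ∀ p, p ∈ helpers p
  /-- Distinctness of the coded subsegments: given the delivered subsegments `D q v` of the other
  servers `q` in `helpers p`, the subsegment `D p v` is uniformly distributed. In particular,
  `D p v` is uniform and independent of the `D q v`. If `helpers p = {p}`, it only says that
  `D p v` is uniform. -/
  uniform : ∀ p (v : Node K) (x : Bits (m p v))
    (w₀ : Bits (len (d v.user) v.cachers)),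
    Fintype.card {w : Bits (len (d v.user) v.cachers) //
        extract p v (store p _ _ w) = x ∧
        ∀ q ∈ helpers p, q ≠ p → extract q v (store q _ _ w) = extract q v (store q _ _ w₀)}
      * 2 ^ m p v
    = Fintype.card {w : Bits (len (d v.user) v.cachers) //
        ∀ q ∈ helpers p, q ≠ p → extract q v (store q _ _ w) = extract q v (store q _ _ w₀)}
  /-- The transmission of server `p`. -/
  encode : ∀ p, (∀ v : Node K, Bits (m p v)) → Bits (n p)
  /-- User `v.user` estimates the subsegment of server `p` for its request `v` from the
  transmissions of those servers in `helpers p` to which it is connected, and from its cache. -/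
  decode : ∀ p (v : Node K),
    (∀ q : {q : Fin P // q ∈ helpers p ∧ q ∈ Z v.user}, Bits (n q.1)) →
    (∀ i (A : {A : Finset (Fin K) // v.user ∈ A}), Bits (len i A.1)) →
    Bits (m p v)

namespace Code

variable {N K P ρ F : ℕ} {Z : Fin K → Finset (Fin P)} {d : Fin K → Fin N} {n : Fin P → ℕ}
  {m : Fin P → Node K → ℕ}

/-- The possible contents of the file library. -/
abbrev Library (c : Code ρ Z d F n m) : Type :=
  ∀ (i : Fin N) (A : Finset (Fin K)), Bits (c.len i A)

/-- The subsegment that server `p` has to deliver for the request `v`. -/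
def piece (c : Code ρ Z d F n m) (W : c.Library) (p : Fin P) (v : Node K) :
    Bits (m p v) :=
  c.extract p v (c.store p (d v.user) v.cachers (W (d v.user) v.cachers))

/-- The message that server `p` transmits. -/
def message (c : Code ρ Z d F n m) (W : c.Library) (p : Fin P) : Bits (n p) :=
  c.encode p (c.piece W p)

/-- The estimate of the subsegment of server `p` for the request `v`. -/
def estimate (c : Code ρ Z d F n m) (W : c.Library) (p : Fin P) (v : Node K) :
    Bits (m p v) :=
  c.decode p v (fun q => c.message W q.1) (fun i A => W i A.1)

/-- The probability, for a uniformly distributed library, that the estimate is wrong. -/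
noncomputable def errorProb (c : Code ρ Z d F n m) (p : Fin P) (v : Node K) : ℝ :=
  (Fintype.card {W : c.Library // c.estimate W p v ≠ c.piece W p v} : ℝ) /
    Fintype.card c.Library

end Code

/-- The rates `r` are achievable, where `r p v` is measured per bit of the total transmission length
`F * ∑ q, R q`: for every `ε > 0` and all large enough file sizes `F` there is a code with
transmissions of `⌊F R_p⌋` bits such that the servers of each user deliver enough bits for each of
its segments, and such that each subsegment is decoded by the user that requests it with error
probability less than `ε`. -/
def Achievable {N K P : ℕ} (ρ : ℕ) (Z : Fin K → Finset (Fin P)) (d : Fin K → Fin N)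
    (R : Fin P → ℝ) (r : Fin P → Node K → ℝ) : Prop :=
  ∀ ε : ℝ, 0 < ε → ∃ F₀ : ℕ, ∀ F ≥ F₀,
    ∃ c : Code ρ Z d F (fun p => ⌊F * R p⌋₊) (fun p v => ⌊F * (∑ q, R q) * r p v⌋₊),
      (∀ v : Node K,
        (c.len (d v.user) v.cachers : ℝ) ≤ ∑ p ∈ Z v.user, F * (∑ q, R q) * r p v) ∧
      ∀ p v, c.errorProb p v < ε

end MultiServer

namespace MultiServer

open Finset

/-! It suffices to bound each server `p` separately, by a counting argument. Freeze the message of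
`p` at a value `x`, while the other helpers keep sending their true messages. For an acyclic set
`J`, exactly a fraction `2 ^ (-∑ m p v)` of the libraries has all subsegments in `J` estimated
correctly (`card_estimateOf_acyclic`). To see this, peel off a sink `v`: no user requesting a node
of `J` caches its segment, so with `x` frozen the estimates see this segment only through the
subsegments of the other helpers. Given those, the subsegment of `p` is still uniform, so it agrees
with its estimate in a fraction `2 ^ (-m p v)` of the cases, whatever happens at the other nodes.
The true message is one of `2 ^ n p` values, and for small error most libraries are decoded
correctly, so `∑ m p v ≤ n p + 1`. Dividing by `F` gives the bound for `p`; summing over `p` gives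
the total. -/

/-- A finite set without a directed cycle contains a vertex without edges into the set. -/
theorem AcyclicOn.exists_sink {V : Type*} {G : Digraph V} {J : Finset V} (h : AcyclicOn G J)
    (hJ : J.Nonempty) : ∃ v ∈ J, ∀ u ∈ J, ¬ G.Adj v u := by
  -- Reachability is reversed, so that a minimal element is a vertex from which nothing in `J` can
  -- be reached.
  let rel : J → J → Prop := fun a b =>
    Relation.TransGen (fun a b => a ∈ J ∧ b ∈ J ∧ G.Adj a b) b.1 a.1
  have : IsTrans J rel := ⟨fun _ _ _ hab hbc => hbc.trans hab⟩
  have : Std.Irrefl rel := ⟨fun a ha => h a.1 ha⟩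
  have wf : WellFounded rel := Finite.wellFounded_of_trans_of_irrefl rel
  obtain ⟨v₀, hv₀⟩ := hJ
  obtain ⟨v, -, hv⟩ := wf.has_min Set.univ ⟨⟨v₀, hv₀⟩, trivial⟩
  exact ⟨v.1, v.2, fun u hu hvu => hv ⟨u, hu⟩ trivial (.single ⟨v.2, hu, hvu⟩)⟩

theorem AcyclicOn.mono {V : Type*} {G : Digraph V} {I J : Finset V} (h : AcyclicOn G J)
    (hIJ : I ⊆ J) : AcyclicOn G I :=
  fun v hv => h v (Relation.TransGen.mono (fun _ _ hab => ⟨hIJ hab.1, hIJ hab.2.1, hab.2.2⟩) v v hv)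

/-! ### Counting with one uniform component -/

/-- Let `get` and `set` read and replace one component of the elements of `α`. If `D` is uniform on
each fibre of `cl`, and if neither `A` nor `f` depends on more of the component than its value
under `cl`, then `D` agrees with `f` on a fraction `1 / M` of `A`. -/
theorem card_filter_mul_of_uniform {α β γ δ : Type*} [Fintype α] [Fintype β]
    (get : α → β) (set : α → β → α) (get_set : ∀ a b, get (set a b) = b)
    (set_get : ∀ a, set a (get a) = a) (set_set : ∀ a b b', set (set a b) b' = set a b')
    (cl : β → γ) (D : β → δ) (M : ℕ)
    (uniform : ∀ x b₀, Nat.card {b // D b = x ∧ cl b = cl b₀} * M = Nat.card {b // cl b = cl b₀})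
    (A : α → Prop) (f : α → δ)
    (hA : ∀ a b, cl b = cl (get a) → (A (set a b) ↔ A a))
    (hf : ∀ a b, cl b = cl (get a) → f (set a b) = f a) :
    Nat.card {a // A a ∧ f a = D (get a)} * M = Nat.card {a // A a} := by
  classical
  -- The function `set a` encodes everything in `a` except the component, so a fibre of `g` varies
  -- only the component, and only within its class under `cl`.
  let g : α → (β → α) × γ := fun a => (set a, cl (get a))
  have g_set : ∀ a b, cl b = cl (get a) → g (set a b) = g a := by
    intro a b hb
    simp only [g, get_set, hb, Prod.mk.injEq, and_true]
    exact funext fun b' => set_set a b b'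
  have eq_set : ∀ a a', g a' = g a → a' = set a (get a') := by
    intro a a' h
    have h1 : set a' = set a := (Prod.ext_iff.1 h).1
    rw [← h1, set_get]
  have fibre : ∀ (p : α → Prop) [DecidablePred p] (a : α),
      #{a' ∈ ({a | p a} : Finset α) | g a' = g a}
        = Nat.card {b // p (set a b) ∧ cl b = cl (get a)} := by
    intro p _ a
    rw [Nat.card_eq_fintype_card, Fintype.card_subtype]
    refine Finset.card_bij' (fun a' _ => get a') (fun b _ => set a b) ?_ ?_ ?_ ?_
    · intro a' h
      simp only [mem_filter, mem_univ, true_and] at h ⊢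
      rw [← eq_set a a' h.2]
      exact ⟨h.1, (Prod.ext_iff.1 h.2).2⟩
    · intro b h
      simp only [mem_filter, mem_univ, true_and] at h ⊢
      exact ⟨h.1, g_set a b h.2⟩
    · intro a' h
      simp only [mem_filter, mem_univ, true_and] at h
      exact (eq_set a a' h.2).symm
    · intro b _
      exact get_set a b
  rw [Nat.card_eq_fintype_card, Nat.card_eq_fintype_card, Fintype.card_subtype,
    Fintype.card_subtype,
    Finset.card_eq_sum_card_fiberwise (f := g) (t := univ.image g)
      (fun a _ => by simp),
    Finset.card_eq_sum_card_fiberwise (f := g) (s := {a | A a}) (t := univ.image g)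
      (fun a _ => by simp), Finset.sum_mul]
  refine Finset.sum_congr rfl fun y hy => ?_
  obtain ⟨a, -, rfl⟩ := Finset.mem_image.1 hy
  rw [fibre A a, fibre (fun a => A a ∧ f a = D (get a)) a]
  by_cases h : A a
  · have h₁ : ∀ b, ((A (set a b) ∧ f (set a b) = D (get (set a b))) ∧ cl b = cl (get a)) ↔
        (D b = f a ∧ cl b = cl (get a)) := by
      intro b
      constructor
      · rintro ⟨⟨_, h2⟩, h3⟩
        rw [hf a b h3, get_set] at h2
        exact ⟨h2.symm, h3⟩
      · rintro ⟨h2, h3⟩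
        exact ⟨⟨(hA a b h3).2 h, by rw [hf a b h3, get_set, h2]⟩, h3⟩
    have h₂ : ∀ b, (A (set a b) ∧ cl b = cl (get a)) ↔ cl b = cl (get a) :=
      fun b => ⟨And.right, fun h3 => ⟨(hA a b h3).2 h, h3⟩⟩
    simp only [h₁, h₂]
    exact uniform _ _
  -- `A` is constant on the fibre, so here both counts vanish.
  · have h₁ : ∀ b, ¬ ((A (set a b) ∧ f (set a b) = D (get (set a b))) ∧ cl b = cl (get a)) :=
      fun b hb => h ((hA a b hb.2).1 hb.1.1)
    have h₂ : ∀ b, ¬ (A (set a b) ∧ cl b = cl (get a)) :=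
      fun b hb => h ((hA a b hb.2).1 hb.1)
    simp [h₁, h₂]

/-! ### Bounds for a single code -/

namespace Code

variable {N K P ρ F : ℕ} {Z : Fin K → Finset (Fin P)} {d : Fin K → Fin N} {n : Fin P → ℕ}
  {m : Fin P → Node K → ℕ}

/-- The segment requested by `v`. -/
def segment (c : Code ρ Z d F n m) (W : c.Library) (v : Node K) :
    Bits (c.len (d v.user) v.cachers) :=
  W (d v.user) v.cachers

/-- The library in which the segment requested by `v` is replaced by `w`. -/
def replaceSegment (c : Code ρ Z d F n m) (v : Node K) (W : c.Library)
    (w : Bits (c.len (d v.user) v.cachers)) : c.Library :=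
  Function.update W (d v.user) (Function.update (W (d v.user)) v.cachers w)

/-- The delivered subsegments, of a segment requested by `v`, of the helpers of `p` other than `p`. -/
def helperPieces (c : Code ρ Z d F n m) (p : Fin P) (v : Node K)
    (w : Bits (c.len (d v.user) v.cachers)) (q : {q // q ∈ c.helpers p ∧ q ≠ p}) : Bits (m q.1 v) :=
  c.extract q.1 v (c.store q.1 _ _ w)

/-- The estimate if the message of server `p` is replaced by `x`. -/
def estimateOf (c : Code ρ Z d F n m) (p : Fin P) (x : Bits (n p)) (W : c.Library) (v : Node K) :
    Bits (m p v) :=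
  c.decode p v (fun q => Function.update (c.message W) p x q.1) (fun i A => W i A.1)

theorem estimateOf_message (c : Code ρ Z d F n m) (p : Fin P) (W : c.Library) (v : Node K) :
    c.estimateOf p (c.message W p) W v = c.estimate W p v := by
  simp [estimateOf, estimate]

theorem estimateOf_of_notMem (c : Code ρ Z d F n m) {p : Fin P} (x : Bits (n p)) (W : c.Library)
    {v : Node K} (hp : p ∉ Z v.user) : c.estimateOf p x W v = c.estimate W p v := by
  unfold estimateOf estimate
  congr 1
  funext q
  exact Function.update_of_ne (fun h => hp (by simpa [h] using q.2.2)) _ _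

theorem segment_replaceSegment (c : Code ρ Z d F n m) (v : Node K) (W : c.Library)
    (w : Bits (c.len (d v.user) v.cachers)) : c.segment (c.replaceSegment v W w) v = w := by
  simp [segment, replaceSegment]

theorem replaceSegment_of_ne (c : Code ρ Z d F n m) (v : Node K) (W : c.Library)
    (w : Bits (c.len (d v.user) v.cachers)) {i : Fin N} {A : Finset (Fin K)}
    (h : i = d v.user → A ≠ v.cachers) : c.replaceSegment v W w i A = W i A := by
  unfold replaceSegment
  by_cases hi : i = d v.user
  · subst hi
    rw [Function.update_self, Function.update_of_ne (h rfl)]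
  · rw [Function.update_of_ne hi]

theorem piece_replaceSegment_of_ne (c : Code ρ Z d F n m) (hd : Function.Injective d)
    {u v : Node K} (h : u ≠ v) (W : c.Library) (w : Bits (c.len (d v.user) v.cachers))
    (p : Fin P) : c.piece (c.replaceSegment v W w) p u = c.piece W p u := by
  unfold piece
  rw [replaceSegment_of_ne]
  exact fun h₁ h₂ => h (Subtype.ext (Prod.ext (hd h₁) h₂))

/-- The segment of `v` could enter the estimate through the cache, excluded by `h`; through the
message of `p`, frozen at `x`; or through the other helpers, whose subsegments of it are unchanged
by `hw`. -/
theorem estimateOf_replaceSegment (c : Code ρ Z d F n m) (hd : Function.Injective d)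
    {p : Fin P} (x : Bits (n p)) {u v : Node K} (h : u.user ∉ v.cachers) (W : c.Library)
    {w : Bits (c.len (d v.user) v.cachers)}
    (hw : c.helperPieces p v w = c.helperPieces p v (c.segment W v)) :
    c.estimateOf p x (c.replaceSegment v W w) u = c.estimateOf p x W u := by
  unfold estimateOf
  congr 1
  · funext q
    by_cases hq : q.1 = p
    · obtain ⟨q, hq'⟩ := q
      obtain rfl : q = p := hq
      simp
    · rw [Function.update_of_ne hq, Function.update_of_ne hq]
      unfold message
      congr 1
      funext t
      by_cases ht : t = v
      · subst ht
        have := congrFun hw ⟨q.1, q.2.1, hq⟩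
        have hs := c.segment_replaceSegment t W w
        unfold segment at hs
        unfold piece
        rw [hs]
        exact this
      · exact c.piece_replaceSegment_of_ne hd ht W w q.1
  · funext i A
    exact c.replaceSegment_of_ne v W w (fun _ hA => h (hA ▸ A.2))

/-- Requiring that one more subsegment be estimated correctly divides the number of libraries by
the number of values of this subsegment, if no earlier request has its segment as side
information. -/
theorem card_estimateOf_insert (c : Code ρ Z d F n m) (hd : Function.Injective d)
    {p : Fin P} (x : Bits (n p)) (v : Node K) (J : Set (Node K)) (hv : v ∉ J)
    (h : ∀ u ∈ J, u.user ∉ v.cachers) :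
    Nat.card {W : c.Library // (∀ u ∈ J, c.estimateOf p x W u = c.piece W p u) ∧
        c.estimateOf p x W v = c.piece W p v} * 2 ^ m p v
      = Nat.card {W : c.Library // ∀ u ∈ J, c.estimateOf p x W u = c.piece W p u} := by
  refine card_filter_mul_of_uniform (fun W => c.segment W v) (c.replaceSegment v)
    (c.segment_replaceSegment v) ?_ ?_ (c.helperPieces p v)
    (fun w => c.extract p v (c.store p _ _ w)) (2 ^ m p v) ?_
    (fun W => ∀ u ∈ J, c.estimateOf p x W u = c.piece W p u) (fun W => c.estimateOf p x W v) ?_ ?_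
  · intro W
    simp [replaceSegment, segment]
  · intro W w w'
    simp [replaceSegment]
  · intro y w₀
    have hc : ∀ w, c.helperPieces p v w = c.helperPieces p v w₀ ↔ ∀ q ∈ c.helpers p, q ≠ p →
        c.extract q v (c.store q _ _ w) = c.extract q v (c.store q _ _ w₀) := by
      intro w
      rw [funext_iff]
      exact ⟨fun h q h₁ h₂ => h ⟨q, h₁, h₂⟩, fun h q => h q.1 q.2.1 q.2.2⟩
    simp only [hc, Nat.card_eq_fintype_card]
    exact c.uniform p v y w₀
  · intro W w hw
    refine forall₂_congr fun u hu => ?_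
    rw [c.estimateOf_replaceSegment hd x (h u hu) W hw,
      c.piece_replaceSegment_of_ne hd (by rintro rfl; exact hv hu)]
  · intro W w hw
    exact c.estimateOf_replaceSegment hd x v.2 W hw

/-- For a fixed message of server `p`, the fraction of libraries for which an acyclic set of
subsegments is estimated correctly. -/
theorem card_estimateOf_acyclic (c : Code ρ Z d F n m) (hd : Function.Injective d)
    {p : Fin P} (x : Bits (n p)) (J : Finset (ServedNode Z p))
    (hJ : AcyclicOn (sideInfoGraph Z p) J) :
    Nat.card {W : c.Library // ∀ v ∈ J, c.estimateOf p x W v.1 = c.piece W p v.1}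
      * 2 ^ ∑ v ∈ J, m p v.1 = Nat.card c.Library := by
  classical
  induction J using Finset.strongInduction with
  | H J ih =>
    rcases J.eq_empty_or_nonempty with rfl | hne
    · simp
    · obtain ⟨v, hv, hs⟩ := hJ.exists_sink hne
      rw [← ih (J.erase v) (Finset.erase_ssubset hv) (hJ.mono (Finset.erase_subset _ _)),
        ← Finset.sum_erase_add J _ hv, pow_add, mul_comm (2 ^ _) (2 ^ _), ← mul_assoc]
      congr 1
      have key := c.card_estimateOf_insert hd x v.1 {u | ∃ t ∈ J.erase v, t.1 = u}
        (by
          rintro ⟨t, ht, htv⟩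
          exact Finset.ne_of_mem_erase ht (Subtype.ext htv))
        (by
          rintro _ ⟨t, ht, rfl⟩
          exact hs t (Finset.mem_of_mem_erase ht))
      simp only [Set.mem_ofPred_eq, forall_exists_index, and_imp, forall_apply_eq_imp_iff₂] at key
      rw [← key]
      congr 2
      refine congrArg Subtype (funext fun W => propext ?_)
      rw [and_comm, ← Finset.forall_mem_insert (p := fun t : ServedNode Z p =>
        c.estimateOf p x W t.1 = c.piece W p t.1), Finset.insert_erase hv]

theorem card_library_pos (c : Code ρ Z d F n m) : 0 < Nat.card c.Library :=
  Nat.card_pos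

/-- The union bound. -/
theorem card_library_le (c : Code ρ Z d F n m) (p : Fin P) {ι : Type*} (J : Finset ι)
    (g : ι → Node K) {ε : ℝ} (h : ∀ v, c.errorProb p v < ε) :
    (1 - #J * ε) * (Nat.card c.Library : ℝ)
      ≤ Nat.card {W : c.Library // ∀ v ∈ J, c.estimate W p (g v) = c.piece W p (g v)} := by
  classical
  have hpos : (0 : ℝ) < Fintype.card c.Library := by
    have := c.card_library_pos
    rw [Nat.card_eq_fintype_card] at this
    exact_mod_cast this
  have hbad : ∀ v, (#{W : c.Library | c.estimate W p v ≠ c.piece W p v} : ℝ)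
      ≤ ε * Fintype.card c.Library := by
    intro v
    have := (h v).le
    rw [errorProb, div_le_iff₀ hpos, Fintype.card_subtype] at this
    convert this
  have hcover : (univ : Finset c.Library) ⊆
      ({W | ∀ v ∈ J, c.estimate W p (g v) = c.piece W p (g v)} : Finset c.Library) ∪
        J.biUnion fun v => {W | c.estimate W p (g v) ≠ c.piece W p (g v)} := by
    intro W _
    simp only [mem_union, mem_filter, mem_univ, true_and, mem_biUnion]
    by_contra! hc
    obtain ⟨⟨v, hv, hne⟩, h2⟩ := hc
    exact hne (h2 v hv)
  have h1 := (Finset.card_le_card hcover).trans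
    ((Finset.card_union_le _ _).trans (Nat.add_le_add_left Finset.card_biUnion_le _))
  have h2 : (Fintype.card c.Library : ℝ) ≤
      #({W | ∀ v ∈ J, c.estimate W p (g v) = c.piece W p (g v)} : Finset c.Library)
        + ∑ v ∈ J, (#{W : c.Library | c.estimate W p (g v) ≠ c.piece W p (g v)} : ℝ) := by
    rw [Finset.card_univ] at h1
    exact_mod_cast h1
  have h3 := Finset.sum_le_sum fun v (_ : v ∈ J) => hbad (g v)
  rw [Finset.sum_const, nsmul_eq_mul] at h3
  rw [Nat.card_eq_fintype_card, Nat.card_eq_fintype_card, Fintype.card_subtype]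
  linarith

/-- At least half of the libraries are decoded correctly, while each value of the message accounts
for a fraction `2 ^ (-∑ m p v)` only. The extra bit pays for the factor `1 / 2`. -/
theorem sum_le_of_acyclic (c : Code ρ Z d F n m) (hd : Function.Injective d) {p : Fin P}
    (J : Finset (ServedNode Z p)) (hJ : AcyclicOn (sideInfoGraph Z p) J) {ε : ℝ}
    (hε : #J * ε ≤ 1 / 2) (h : ∀ v, c.errorProb p v < ε) :
    ∑ v ∈ J, m p v.1 ≤ n p + 1 := by
  classical
  have hpos : (0 : ℝ) < Nat.card c.Library := by exact_mod_cast c.card_library_pos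
  have h1 := c.card_library_le p J (fun v => v.1) h
  have h2 : Nat.card {W : c.Library // ∀ v ∈ J, c.estimate W p v.1 = c.piece W p v.1} ≤
      ∑ x : Bits (n p),
        Nat.card {W : c.Library // ∀ v ∈ J, c.estimateOf p x W v.1 = c.piece W p v.1} := by
    simp only [Nat.card_eq_fintype_card, Fintype.card_subtype]
    refine le_trans (Finset.card_le_card ?_) Finset.card_biUnion_le
    intro W hW
    simp only [mem_filter, mem_univ, true_and, mem_biUnion] at hW ⊢
    exact ⟨c.message W p, fun v hv => by rw [estimateOf_message, hW v hv]⟩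
  have h3 := Nat.mul_le_mul_right (2 ^ ∑ v ∈ J, m p v.1) h2
  simp only [Finset.sum_mul, c.card_estimateOf_acyclic hd _ J hJ, Finset.sum_const,
    Finset.card_univ, smul_eq_mul, Fintype.card_fun, Fintype.card_bool, Fintype.card_fin] at h3
  have h4 : (Nat.card {W : c.Library // ∀ v ∈ J, c.estimate W p v.1 = c.piece W p v.1} : ℝ)
      * 2 ^ (∑ v ∈ J, m p v.1) ≤ 2 ^ n p * Nat.card c.Library := by exact_mod_cast h3
  have h5 : (1 / 2 : ℝ) * Nat.card c.Library * 2 ^ (∑ v ∈ J, m p v.1)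
      ≤ 2 ^ n p * Nat.card c.Library := by
    refine le_trans (mul_le_mul_of_nonneg_right (le_trans ?_ h1) (by positivity)) h4
    exact mul_le_mul_of_nonneg_right (by linarith) hpos.le
  have h6 : (2 : ℝ) ^ (∑ v ∈ J, m p v.1) ≤ 2 ^ (n p + 1) := by
    rw [pow_succ]
    refine le_of_mul_le_mul_right ?_ hpos
    linarith
  exact (pow_le_pow_iff_right₀ one_lt_two).1 h6

/-- Without the message of `p`, the estimate is a guess at a uniform string: even one bit is right
at most half of the time, whereas success above `3 / 4` is assumed. -/
theorem eq_zero_of_notMem (c : Code ρ Z d F n m) (hd : Function.Injective d) {p : Fin P}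
    {v : Node K} (hp : p ∉ Z v.user) (h : ∀ v, c.errorProb p v < 1 / 4) : m p v = 0 := by
  have hpos : (0 : ℝ) < Nat.card c.Library := by exact_mod_cast c.card_library_pos
  have h1 := c.card_library_le p {()} (fun _ => v) h
  -- The all-zero message is arbitrary, as this user does not receive it.
  have h2 := c.card_estimateOf_insert hd (p := p) (fun _ => false) v ∅ (by simp) (by simp)
  simp only [Set.mem_empty_iff_false, false_imp_iff, implies_true, true_and,
    c.estimateOf_of_notMem _ _ hp, Nat.card_congr (Equiv.subtypeUnivEquiv fun _ => trivial)] at h2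
  simp only [card_singleton, Nat.cast_one, one_mul, mem_singleton, forall_const] at h1
  by_contra hm
  have h3 : (2 : ℝ) ≤ 2 ^ m p v := le_self_pow₀ one_le_two hm
  have h4 : (Nat.card {W : c.Library // c.estimate W p v = c.piece W p v} : ℝ) * 2 ^ m p v
      = Nat.card c.Library := by exact_mod_cast h2
  have h5 := mul_le_mul_of_nonneg_left h3
    (Nat.cast_nonneg (α := ℝ) (Nat.card {W : c.Library // c.estimate W p v = c.piece W p v}))
  linarith

end Code

/-! ### Passage to large files -/

/-- If `n * a ≤ n * b + C` for all large `n`, then `a ≤ b`. -/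
theorem le_of_forall_large_mul_le {a b C : ℝ} {n₀ : ℕ}
    (h : ∀ n : ℕ, n₀ ≤ n → n * a ≤ n * b + C) : a ≤ b := by
  by_contra! hab
  obtain ⟨k, hk⟩ := exists_nat_gt (C / (a - b))
  rw [div_lt_iff₀ (sub_pos.2 hab)] at hk
  have h1 := h (max n₀ k) (le_max_left _ _)
  have h2 : (k : ℝ) ≤ (max n₀ k : ℕ) := by exact_mod_cast le_max_right n₀ k
  have h3 := mul_le_mul_of_nonneg_right h2 (sub_pos.2 hab).le
  nlinarith

end MultiServer

open MultiServer in
theorem mainTheorem3 {N K P : ℕ} (ρ : ℕ) (Z : Fin K → Finset (Fin P)) (hZ : ∀ j, (Z j).card = ρ)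
    (d : Fin K → Fin N) (hd : Function.Injective d)
    (R : Fin P → ℝ) (hR : ∀ p, 0 ≤ R p) (hT : 0 < ∑ p, R p)
    (r : Fin P → MultiServer.Node K → ℝ) (hr : ∀ p v, 0 ≤ r p v)
    (h : MultiServer.Achievable ρ Z d R r) :
    (∀ p (v : MultiServer.Node K), p ∉ Z v.user → r p v = 0) ∧
    (∀ J : (p : Fin P) → Finset (MultiServer.ServedNode Z p),
      (∀ p, MultiServer.AcyclicOn (MultiServer.sideInfoGraph Z p) (J p)) →
      (∑ p, ∑ v ∈ J p, r p v.1 ≤ 1) ∧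
      ∀ p, (∑ q, R q) * ∑ v ∈ J p, r p v.1 ≤ R p) := by
  refine ⟨fun p v hp => ?_, fun J hJ => ?_⟩
  · obtain ⟨F₀, hF⟩ := h (1 / 4) (by norm_num)
    have hle : (∑ q, R q) * r p v ≤ 0 := by
      refine le_of_forall_large_mul_le (C := 1) (n₀ := F₀) fun F hF' => ?_
      obtain ⟨c, -, hc⟩ := hF F hF'
      have h0 := c.eq_zero_of_notMem hd hp (hc p)
      rw [Nat.floor_eq_zero] at h0
      linarith
    exact le_antisymm (nonpos_of_mul_nonpos_right hle hT) (hr p v)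
  · have key : ∀ p, (∑ q, R q) * ∑ v ∈ J p, r p v.1 ≤ R p := by
      intro p
      have hpos : (0 : ℝ) < 2 * ((J p).card + 1) := by positivity
      -- This error makes the union bound over `J p` at most `1 / 2`; the `+ 1` covers empty `J p`.
      obtain ⟨F₀, hF⟩ := h (1 / (2 * ((J p).card + 1))) (by positivity)
      -- Each floor on the left loses at most one bit, and the bound on the code loses one more.
      refine le_of_forall_large_mul_le (C := (J p).card + 1) (n₀ := F₀) fun F hF' => ?_
      obtain ⟨c, -, hc⟩ := hF F hF'
      have h1 := c.sum_le_of_acyclic hd (J p) (hJ p)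
        (by rw [mul_one_div, div_le_div_iff₀ hpos two_pos]; linarith) (hc p)
      have h2 : ∑ v ∈ J p, (⌊F * (∑ q, R q) * r p v.1⌋₊ : ℝ) ≤ ⌊F * R p⌋₊ + 1 := by
        exact_mod_cast h1
      have h3 := Nat.floor_le (mul_nonneg (Nat.cast_nonneg (α := ℝ) F) (hR p))
      have h4 : ∑ v ∈ J p, (F * (∑ q, R q) * r p v.1 - 1)
          ≤ ∑ v ∈ J p, (⌊F * (∑ q, R q) * r p v.1⌋₊ : ℝ) :=
        Finset.sum_le_sum fun v _ => (Nat.sub_one_lt_floor _).le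
      rw [Finset.sum_sub_distrib, ← Finset.mul_sum, Finset.sum_const, nsmul_eq_mul] at h4
      linarith
    refine ⟨?_, key⟩
    have h1 := Finset.sum_le_sum fun p (_ : p ∈ Finset.univ) => key p
    rw [← Finset.mul_sum] at h1
    exact le_of_mul_le_mul_left (by linarith) hT
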